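/- Notation. $\mathbb D$ is the open unit disk, $\mathbb T$ the unit circle, $m$ the normalized Lebesgue measure on $\mathbb T$. The Schur class $\mathcal S$ is the set of holomorphic functions $s$ on $\mathbb D$ with $|s|\le 1$. An inner function is a function in $\mathcal S$ whose radial boundary values exist and are unimodular $m$-a.e. on $\mathbb T$. For an inner function $\Theta$ let $K_\Theta=H^2\ominus\Theta H^2$ be its model space, and let $S(\Theta)$ be the set of all finite positive Borel measures $\sigma$ on $\mathbb T$ for which the identity embeds $K_\Theta$ isometrically in $L^2_\sigma(\mathbb T)$, that is, every $f\in K_\Theta$ has radial boundary values $\sigma$-a.e. that form a function in $L^2_\sigma(\mathbb T)$, and $\int_{\mathbb T} f\bar g\,d\sigma=\int_{\mathbb T} f\bar g\,dm$ for all $f,g\in K_\Theta$. A function $\omega\in\mathcal S$ is called a parameter of $\sigma$ if $\Theta\omega\neq 1$ on $\mathbb D$ and, for some real $\beta$, $$\frac{1+\Theta(z)\omega(z)}{1-\Theta(z)\omega(z)}=i\beta+\int_{\mathbb T}\frac{t+z}{t-z}\,\sigma(dt),\qquad z\in\mathbb D.$$ For $s_1,s_2\in\mathcal S$ the $\Theta$-product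 is $$(s_1\circ s_2)_\Theta=\frac{s_0-\Theta s_1s_2}{1-\Theta s_0},\qquad s_0=\frac{s_1+s_2}2 .$$ Call the pair $(s_1,s_2)$ degenerate if $\Theta$ is a constant $c$ and $s_1=s_2=\bar c$ on $\mathbb D$ (then the formula reads $0/0$); this never occurs for nonconstant $\Theta$. Proposition 3. Let $\Theta$ be an inner function. (1) For every nondegenerate pair $s_1,s_2\in\mathcal S$ the denominator $1-\Theta s_0$ has no zeros in $\mathbb D$, and $(s_1\circ s_2)_\Theta\in\mathcal S$. (2) The operation is idempotent: $(s\circ s)_\Theta=s$ for every $s\in\mathcal S$ such that the pair $(s,s)$ is nondegenerate. (3) If $\Theta$ is nonconstant and $s_1,s_2\in\mathcal S$, then $(s_1\circ s_2)_\Theta$ is an inner function if and only if both $s_1$ and $s_2$ are inner functions. (4) If $\sigma_1,\sigma_2\in S(\Theta)$, then $\sigma=\frac12(\sigma_1+\sigma_2)\in S(\Theta)$; and if $\omega_j$ is a parameter of $\sigma_j$, $j=1,2$, then $(\omega_1\circ\omega_2)_\Theta$ is a parameter of $\sigma$. If moreover $\Theta$ is nonconstant, it is the only parameter of $\sigma$.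 -/

import Mathlib

open MeasureTheory Filter Topology Metric
open scoped ComplexConjugate

namespace ThetaProduct

/-- The Borel sigma-algebra of the unit circle. -/
noncomputable instance circleMeasurableSpace : MeasurableSpace Circle := borel Circle

instance circleBorelSpace : BorelSpace Circle := ⟨rfl⟩

/-- The open unit disk. -/
abbrev disk : Set ℂ := ball (0 : ℂ) 1

/-- The normalized Lebesgue measure `m` on the unit circle. -/
noncomputable def m : Measure Circle :=
  (ENNReal.ofReal (2 * Real.pi))⁻¹ •
    (volume.restrict (Set.Ioc (-Real.pi) Real.pi)).map (fun x : ℝ => Circle.exp x)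

/-- `f` has the radial limit `w` at the point `t` of the unit circle. -/
def HasRadialLimit (f : ℂ → ℂ) (t : Circle) (w : ℂ) : Prop :=
  Tendsto (fun r : ℝ => f ((r : ℂ) * (t : ℂ))) (𝓝[<] 1) (𝓝 w)

/-- The boundary function `t ↦ lim_{r → 1-} f (r t)`; its value is meaningful at those `t` where
the radial limit exists. -/
noncomputable def boundary (f : ℂ → ℂ) (t : Circle) : ℂ :=
  limUnder (𝓝[<] (1 : ℝ)) (fun r : ℝ => f ((r : ℂ) * (t : ℂ)))

/-- The Schur class: functions holomorphic in the unit disk and bounded there by `1`.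
Values outside the disk are irrelevant. -/
def schurClass : Set (ℂ → ℂ) :=
  {s | DifferentiableOn ℂ s disk ∧ ∀ z ∈ disk, ‖s z‖ ≤ 1}

/-- Inner functions: Schur functions with unimodular boundary values almost everywhere. -/
def IsInner (f : ℂ → ℂ) : Prop :=
  f ∈ schurClass ∧ ∀ᵐ t ∂m, ∃ w : ℂ, ‖w‖ = 1 ∧ HasRadialLimit f t w

/-- `f` is constant in the unit disk. -/
def IsConstOnDisk (f : ℂ → ℂ) : Prop := ∃ c : ℂ, ∀ z ∈ disk, f z = c

/-- The Hardy space `H²` of the unit disk. -/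
def hardyTwo : Set (ℂ → ℂ) :=
  {f | DifferentiableOn ℂ f disk ∧
    ∃ C : ℝ, ∀ r : ℝ, 0 ≤ r → r < 1 → ∫ t : Circle, ‖f ((r : ℂ) * (t : ℂ))‖ ^ 2 ∂m ≤ C}

/-- The model space `K_Θ = H² ⊖ Θ H²`, with the inner product of `H²` computed from the boundary
functions in `L²(m)`. -/
def modelSpace (Θ : ℂ → ℂ) : Set (ℂ → ℂ) :=
  {f | f ∈ hardyTwo ∧ ∀ h ∈ hardyTwo,
    ∫ t : Circle, boundary f t * conj (boundary (fun z => Θ z * h z) t) ∂m = 0}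

/-- The set of all finite positive Borel measures `σ` on the unit circle for which the identity
operator embeds `K_Θ` isometrically in `L²(σ)`. The elements of `K_Θ` act on the circle through
their boundary values, which therefore have to exist `σ`-almost everywhere. -/
def isometricMeasures (Θ : ℂ → ℂ) : Set (Measure Circle) :=
  {σ | IsFiniteMeasure σ ∧
    (∀ f ∈ modelSpace Θ,
      (∀ᵐ t ∂σ, ∃ w : ℂ, HasRadialLimit f t w) ∧ MemLp (boundary f) 2 σ) ∧
    ∀ f ∈ modelSpace Θ, ∀ g ∈ modelSpace Θ,
      ∫ t : Circle, boundary f t * conj (boundary g t) ∂σ =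
        ∫ t : Circle, boundary f t * conj (boundary g t) ∂m}

/-- The Schur function `ω` is a parameter of the measure `σ`:
`(1 + Θ ω) / (1 - Θ ω) = i β + ∫ (t + z) / (t - z) σ(dt)` in the unit disk for some real `β`. -/
def IsParameter (Θ : ℂ → ℂ) (σ : Measure Circle) (ω : ℂ → ℂ) : Prop :=
  ω ∈ schurClass ∧ (∀ z ∈ disk, 1 - Θ z * ω z ≠ 0) ∧
    ∃ β : ℝ, ∀ z ∈ disk,
      (1 + Θ z * ω z) / (1 - Θ z * ω z) =
        Complex.I * (β : ℂ) + ∫ t : Circle, ((t : ℂ) + z) / ((t : ℂ) - z) ∂σ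

/-- The half-sum `s₀ = (s₁ + s₂) / 2`. -/
noncomputable def halfSum (s₁ s₂ : ℂ → ℂ) : ℂ → ℂ := fun z => (s₁ z + s₂ z) / 2

/-- The `Θ`-product `(s₀ - Θ s₁ s₂) / (1 - Θ s₀)` of `s₁` and `s₂`. -/
noncomputable def thetaProduct (Θ s₁ s₂ : ℂ → ℂ) : ℂ → ℂ := fun z =>
  (halfSum s₁ s₂ z - Θ z * s₁ z * s₂ z) / (1 - Θ z * halfSum s₁ s₂ z)

/-- The degenerate case, in which the formula of the `Θ`-product reads `0 / 0`:
`Θ` is a constant `c` and both factors are the constant `conj c` in the unit disk. -/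
def Degenerate (Θ s₁ s₂ : ℂ → ℂ) : Prop :=
  ∃ c : ℂ, ∀ z ∈ disk, Θ z = c ∧ s₁ z = conj c ∧ s₂ z = conj c

end ThetaProduct

/-! The first three claims rest on one identity, `sq_norm_sub_sq_norm_product`: the squared modulus
of the denominator minus that of the numerator is a sum of the defects `1 - ‖x‖²`, `1 - ‖y‖²`, `1 -
‖a‖²` with nonnegative weights. In the disk this gives contractivity. At almost every boundary point
`‖a‖ = 1`, so the product is unimodular there exactly when both factors are, as long as the weights
`‖1 - a * y‖²`, `‖1 - a * x‖²` do not vanish. They vanish almost nowhere, because `log ‖1 - u‖` has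
a finite mean when the Schur function `u` omits the value `1` (`ae_not_hasRadialLimit_one`). Passing
from the product back to its factors also needs their radial limits to exist, which is Fatou's
theorem (`ae_exists_hasRadialLimit`).

For measures, `1 / (1 - Θ ω)` is an affine function of the Cayley transform, and the `Θ`-product is
the operation on `ω` that averages this quantity. Averaging Herglotz integrals therefore multiplies
parameters. Two parameters of one measure could still differ through `β`; then `Θ` would divide a
product of two nonvanishing functions with nonnegative real part. Such functions are outer, so a
nonconstant inner `Θ` cannot divide them (`not_eq_inner_mul`). -/

namespace ThetaProduct

/-! ### Contractivity and nonvanishing denominators in the disk -/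

/-- The norm identity behind the contractivity of the `Θ`-product. -/
theorem sq_norm_sub_sq_norm_product (a x y : ℂ) :
    ‖1 - a * ((x + y) / 2)‖ ^ 2 - ‖(x + y) / 2 - a * x * y‖ ^ 2 =
      (1 - ‖x‖ ^ 2) * ‖1 - a * y‖ ^ 2 / 2 + (1 - ‖y‖ ^ 2) * ‖1 - a * x‖ ^ 2 / 2 +
        (1 - ‖a‖ ^ 2) * ‖x - y‖ ^ 2 / 4 := by
  obtain ⟨a₁, a₂⟩ := a
  obtain ⟨x₁, x₂⟩ := x
  obtain ⟨y₁, y₂⟩ := y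
  have h : ((⟨x₁, x₂⟩ : ℂ) + ⟨y₁, y₂⟩) / 2 = ⟨(x₁ + y₁) / 2, (x₂ + y₂) / 2⟩ := by
    apply Complex.ext <;> simp
  rw [h]
  simp only [Complex.sq_norm, Complex.normSq_apply, Complex.sub_re, Complex.sub_im,
    Complex.mul_re, Complex.mul_im, Complex.one_re, Complex.one_im]
  ring

theorem norm_product_le {a x y : ℂ} (ha : ‖a‖ ≤ 1) (hx : ‖x‖ ≤ 1) (hy : ‖y‖ ≤ 1) :
    ‖(x + y) / 2 - a * x * y‖ ≤ ‖1 - a * ((x + y) / 2)‖ := by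
  have h := sq_norm_sub_sq_norm_product a x y
  have h1 : ∀ {w : ℂ}, ‖w‖ ≤ 1 → 0 ≤ 1 - ‖w‖ ^ 2 := fun {w} hw => by
    nlinarith [norm_nonneg w]
  have := mul_nonneg (h1 hx) (sq_nonneg ‖1 - a * y‖)
  have := mul_nonneg (h1 hy) (sq_nonneg ‖1 - a * x‖)
  have := mul_nonneg (h1 ha) (sq_nonneg ‖x - y‖)
  exact le_of_sq_le_sq (by linarith) (norm_nonneg _)

/-- If two points of the closed unit disk have midpoint `1`, both are `1`. -/
theorem eq_one_of_midpoint_eq_one {x y : ℂ} (hx : ‖x‖ ≤ 1) (hy : ‖y‖ ≤ 1)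
    (h : (x + y) / 2 = 1) : x = 1 := by
  have hxr := (Complex.re_le_norm x).trans hx
  have hyr := (Complex.re_le_norm y).trans hy
  have hs : x + y = 2 := by linear_combination 2 * h
  have hre : x.re + y.re = 2 := by simpa using congrArg Complex.re hs
  have h1 : x.re = 1 := by linarith
  have h2 : x.re ^ 2 + x.im ^ 2 ≤ 1 := by
    have : ‖x‖ ^ 2 ≤ 1 := by nlinarith [norm_nonneg x]
    rw [Complex.sq_norm, Complex.normSq_apply] at this
    linarith
  have h3 : x.im = 0 := by
    rw [h1] at h2
    nlinarith [sq_nonneg x.im]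
  exact Complex.ext (by simpa using h1) (by simpa using h3)

theorem norm_mul_le_one {a x : ℂ} (ha : ‖a‖ ≤ 1) (hx : ‖x‖ ≤ 1) : ‖a * x‖ ≤ 1 := by
  rw [norm_mul]
  exact mul_le_one₀ ha (norm_nonneg _) hx

theorem schurClass_mul {s t : ℂ → ℂ} (hs : s ∈ schurClass) (ht : t ∈ schurClass) :
    (fun z => s z * t z) ∈ schurClass :=
  ⟨hs.1.mul ht.1, fun z hz => norm_mul_le_one (hs.2 z hz) (ht.2 z hz)⟩

theorem halfSum_mem_schurClass {s t : ℂ → ℂ} (hs : s ∈ schurClass) (ht : t ∈ schurClass) :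
    halfSum s t ∈ schurClass := by
  refine ⟨(hs.1.add ht.1).div_const 2, fun z hz => ?_⟩
  have := norm_add_le (s z) (t z)
  have h1 := hs.2 z hz
  have h2 := ht.2 z hz
  simp only [halfSum, norm_div, Complex.norm_ofNat]
  linarith

/-- A Schur function of modulus `1` at some point of the disk is constant. -/
theorem eqOn_const_of_norm_eq_one {s : ℂ → ℂ} (hs : s ∈ schurClass) {z₀ : ℂ} (hz₀ : z₀ ∈ disk)
    (h : 1 ≤ ‖s z₀‖) : ∀ z ∈ disk, s z = s z₀ := by
  have := Complex.eqOn_of_isPreconnected_of_isMaxOn_norm (convex_ball (0 : ℂ) 1).isPreconnected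
    isOpen_ball hs.1 hz₀ (fun z hz => (hs.2 z hz).trans h)
  exact fun z hz => this hz

/-- A product of two Schur functions equals `1` somewhere in the disk only if both are
constants, conjugate to each other. -/
theorem eq_conj_of_mul_eq_one {s t : ℂ → ℂ} (hs : s ∈ schurClass) (ht : t ∈ schurClass) {z₀ : ℂ}
    (hz₀ : z₀ ∈ disk) (h : s z₀ * t z₀ = 1) : ∀ z ∈ disk, s z = s z₀ ∧ t z = conj (s z₀) := by
  have hn : ‖s z₀‖ * ‖t z₀‖ = 1 := by rw [← norm_mul, h, norm_one]
  have h1 := hs.2 z₀ hz₀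
  have h2 := ht.2 z₀ hz₀
  have hs1 : 1 ≤ ‖s z₀‖ := by nlinarith [norm_nonneg (s z₀), norm_nonneg (t z₀)]
  have ht1 : 1 ≤ ‖t z₀‖ := by nlinarith [norm_nonneg (s z₀), norm_nonneg (t z₀)]
  have hc : s z₀ * conj (s z₀) = 1 := by
    rw [Complex.mul_conj, Complex.normSq_eq_norm_sq, le_antisymm h1 hs1]
    simp
  have hne : s z₀ ≠ 0 := left_ne_zero_of_mul_eq_one h
  intro z hz
  refine ⟨eqOn_const_of_norm_eq_one hs hz₀ hs1 z hz, ?_⟩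
  rw [eqOn_const_of_norm_eq_one ht hz₀ ht1 z hz]
  exact mul_left_cancel₀ hne (h.trans hc.symm)

theorem one_sub_mul_ne_zero {Θ s : ℂ → ℂ} (hΘ : Θ ∈ schurClass) (hs : s ∈ schurClass)
    (hc : ¬ IsConstOnDisk Θ) : ∀ z ∈ disk, 1 - Θ z * s z ≠ 0 := fun z hz h =>
  hc ⟨Θ z, fun w hw =>
    (eq_conj_of_mul_eq_one hΘ hs hz (sub_eq_zero.1 h).symm w hw).1⟩

/-- Since `1` is an extreme point of the closed disk, a zero of the denominator forces `Θ s₁ = Θ s₂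
= 1` at that point. The maximum principle then makes all three functions constant, which is the
degenerate case. -/
theorem one_sub_mul_halfSum_ne_zero {Θ s₁ s₂ : ℂ → ℂ} (hΘ : Θ ∈ schurClass)
    (h₁ : s₁ ∈ schurClass) (h₂ : s₂ ∈ schurClass) (h : ¬ Degenerate Θ s₁ s₂) :
    ∀ z ∈ disk, 1 - Θ z * halfSum s₁ s₂ z ≠ 0 := by
  intro z₀ hz₀ h0
  have h1 : Θ z₀ * halfSum s₁ s₂ z₀ = 1 := (sub_eq_zero.1 h0).symm
  have hmid : (Θ z₀ * s₁ z₀ + Θ z₀ * s₂ z₀) / 2 = 1 := by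
    rw [← h1, halfSum]
    ring
  have hn₁ := norm_mul_le_one (hΘ.2 z₀ hz₀) (h₁.2 z₀ hz₀)
  have hn₂ := norm_mul_le_one (hΘ.2 z₀ hz₀) (h₂.2 z₀ hz₀)
  have e₁ := eq_one_of_midpoint_eq_one hn₁ hn₂ hmid
  have e₂ := eq_one_of_midpoint_eq_one hn₂ hn₁ (by rw [add_comm]; exact hmid)
  exact h ⟨Θ z₀, fun z hz => ⟨(eq_conj_of_mul_eq_one hΘ h₁ hz₀ e₁ z hz).1,
    (eq_conj_of_mul_eq_one hΘ h₁ hz₀ e₁ z hz).2, (eq_conj_of_mul_eq_one hΘ h₂ hz₀ e₂ z hz).2⟩⟩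

theorem thetaProduct_mem_schurClass {Θ s₁ s₂ : ℂ → ℂ} (hΘ : Θ ∈ schurClass)
    (h₁ : s₁ ∈ schurClass) (h₂ : s₂ ∈ schurClass)
    (h : ∀ z ∈ disk, 1 - Θ z * halfSum s₁ s₂ z ≠ 0) : thetaProduct Θ s₁ s₂ ∈ schurClass := by
  have h0 := (halfSum_mem_schurClass h₁ h₂).1
  refine ⟨DifferentiableOn.div (h0.sub ((hΘ.1.mul h₁.1).mul h₂.1))
    ((differentiableOn_const 1).sub (hΘ.1.mul h0)) h, fun z hz => ?_⟩
  rw [thetaProduct, norm_div]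
  exact div_le_one_of_le₀ (norm_product_le (hΘ.2 z hz) (h₁.2 z hz) (h₂.2 z hz)) (norm_nonneg _)

theorem thetaProduct_self {Θ s : ℂ → ℂ} {z : ℂ} (h : 1 - Θ z * halfSum s s z ≠ 0) :
    thetaProduct Θ s s z = s z := by
  rw [thetaProduct, div_eq_iff h, halfSum]
  ring

/-! ### Lebesgue measure on the circle and circle averages -/

theorem measurable_circleExp : Measurable (fun x : ℝ => Circle.exp x) :=
  Circle.exp.continuous.measurable

instance isProbabilityMeasure_m : IsProbabilityMeasure m := by
  constructor
  have hpi : 0 < 2 * Real.pi := Real.two_pi_pos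
  rw [m, Measure.smul_apply, Measure.map_apply measurable_circleExp MeasurableSet.univ,
    Set.preimage_univ, Measure.restrict_apply_univ, Real.volume_Ioc, smul_eq_mul]
  rw [show Real.pi - -Real.pi = 2 * Real.pi by ring]
  exact ENNReal.inv_mul_cancel (by simpa using hpi) ENNReal.ofReal_ne_top

/-- A property that holds at `exp (iθ)` for almost every real `θ` holds almost everywhere on the
circle. -/
theorem ae_m_of_ae {P : Circle → Prop} (h : ∀ᵐ x : ℝ, P (Circle.exp x)) : ∀ᵐ t ∂m, P t := by
  -- `P` need not be measurable, so its exceptional set is enlarged to a measurable null set before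
  -- being carried to the circle by `arg`.
  obtain ⟨N, hN, hNm, hN0⟩ := exists_measurable_superset_of_null h
  have harg : Measurable (fun t : Circle => Complex.arg t) :=
    Complex.measurable_arg.comp
      (Continuous.measurable (by fun_prop : Continuous fun t : Circle => (t : ℂ)))
  have hsub : {t : Circle | ¬ P t} ⊆ (fun t : Circle => Complex.arg t) ⁻¹' N := by
    intro t ht
    apply hN
    simpa [Circle.exp_arg] using ht
  refine measure_mono_null hsub ?_
  rw [m, Measure.smul_apply, Measure.map_apply measurable_circleExp (harg hNm),
    Measure.restrict_apply (measurable_circleExp (harg hNm))]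
  have : (fun x : ℝ => Circle.exp x) ⁻¹' ((fun t : Circle => Complex.arg t) ⁻¹' N) ∩
      Set.Ioc (-Real.pi) Real.pi ⊆ N := by
    rintro x ⟨hx, hx'⟩
    rwa [Set.mem_preimage, Set.mem_preimage, Circle.arg_exp hx'.1 hx'.2] at hx
  rw [measure_mono_null this hN0, smul_zero]

/-- Integration over the circle as a circle average. -/
theorem integral_m_eq_circleAverage {E : Type*} [NormedAddCommGroup E] [NormedSpace ℝ E]
    {f : ℂ → E} {r : ℝ} (hf : Continuous fun t : Circle => f ((r : ℂ) * t)) :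
    ∫ t : Circle, f ((r : ℂ) * t) ∂m = Real.circleAverage f 0 r := by
  rw [m, integral_smul_measure, integral_map measurable_circleExp.aemeasurable
    hf.aestronglyMeasurable, Real.circleAverage, ENNReal.toReal_inv,
    ENNReal.toReal_ofReal Real.two_pi_pos.le]
  congr 1
  have hper : Function.Periodic (fun θ : ℝ => f (circleMap 0 r θ)) (2 * Real.pi) :=
    fun x => by simp [periodic_circleMap 0 r x]
  have h := hper.intervalIntegral_add_eq 0 (-Real.pi)
  rw [zero_add, show -Real.pi + 2 * Real.pi = Real.pi by ring] at h
  rw [h, intervalIntegral.integral_of_le (by linarith [Real.pi_pos])]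
  simp [circleMap, Circle.coe_exp]

theorem mul_mem_disk {r : ℝ} (hr : r ∈ Set.Ico (0 : ℝ) 1) (t : Circle) :
    (r : ℂ) * (t : ℂ) ∈ disk := by
  rw [mem_ball_zero_iff, norm_mul, Circle.norm_coe, mul_one, Complex.norm_real,
    Real.norm_of_nonneg hr.1]
  exact hr.2

theorem continuous_dilate {f : ℂ → ℂ} (hf : ContinuousOn f disk) {r : ℝ}
    (hr : r ∈ Set.Ico (0 : ℝ) 1) : Continuous fun t : Circle => f ((r : ℂ) * t) :=
  hf.comp_continuous (by fun_prop) (mul_mem_disk hr)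

/-- Mean value property of holomorphic functions, for the measure `m`. -/
theorem integral_m_dilate {f : ℂ → ℂ} (hf : DifferentiableOn ℂ f disk) {r : ℝ}
    (hr : r ∈ Set.Ico (0 : ℝ) 1) : ∫ t : Circle, f ((r : ℂ) * t) ∂m = f 0 := by
  rw [integral_m_eq_circleAverage (continuous_dilate hf.continuousOn hr)]
  refine DiffContOnCl.circleAverage (DifferentiableOn.diffContOnCl_ball hf ?_)
  rw [abs_of_nonneg hr.1]
  exact closedBall_subset_ball hr.2

/-- A sequence of radii increasing to `1`. -/
noncomputable def radius (n : ℕ) : ℝ := 1 - 1 / ((n : ℝ) + 1)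

theorem radius_mem (n : ℕ) : radius n ∈ Set.Ico (0 : ℝ) 1 := by
  have : (0 : ℝ) < (n : ℝ) + 1 := by positivity
  constructor
  · rw [radius, sub_nonneg, div_le_one this]
    linarith [(Nat.cast_nonneg n : (0 : ℝ) ≤ n)]
  · rw [radius]
    linarith [one_div_pos.2 this]

theorem tendsto_radius : Tendsto radius atTop (𝓝[<] 1) := by
  refine tendsto_nhdsWithin_iff.2 ⟨?_, .of_forall fun n => (radius_mem n).2⟩
  have := (tendsto_one_div_add_atTop_nhds_zero_nat (𝕜 := ℝ)).const_sub 1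
  rwa [sub_zero] at this

theorem HasRadialLimit.tendsto_radius {f : ℂ → ℂ} {t : Circle} {w : ℂ}
    (h : HasRadialLimit f t w) : Tendsto (fun n => f ((radius n : ℂ) * t)) atTop (𝓝 w) :=
  Tendsto.comp (g := fun r : ℝ => f ((r : ℂ) * t)) h ThetaProduct.tendsto_radius

theorem eventually_mem_Ico : ∀ᶠ r : ℝ in 𝓝[<] 1, r ∈ Set.Ico (0 : ℝ) 1 :=
  mem_of_superset (Ioo_mem_nhdsLT one_pos) Set.Ioo_subset_Ico_self

/-! ### Boundary uniqueness at the value 1 -/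

/-- A Schur function without the value `1` in the disk has radial limit `1` almost nowhere. -/
theorem ae_not_hasRadialLimit_one {u : ℂ → ℂ} (hu : u ∈ schurClass)
    (h1 : ∀ z ∈ disk, 1 - u z ≠ 0) : ∀ᵐ t ∂m, ¬ HasRadialLimit u t 1 := by
  -- The factor `1/2` gives `-log ‖v‖ ≥ 0`, as Fatou's lemma requires. This function is harmonic, so
  -- its means over all circles equal its finite value at `0`, while a radial limit `1` of `u` would
  -- send it to infinity.
  set v : ℂ → ℂ := fun z => (1 - u z) / 2 with hv
  have hvd : DifferentiableOn ℂ v disk := ((differentiableOn_const 1).sub hu.1).div_const 2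
  have hv0 : ∀ z ∈ disk, v z ≠ 0 := fun z hz => div_ne_zero (h1 z hz) two_ne_zero
  have hv1 : ∀ z ∈ disk, ‖v z‖ ≤ 1 := by
    intro z hz
    have := norm_sub_le 1 (u z)
    have := hu.2 z hz
    simp only [hv, norm_div, Complex.norm_ofNat]
    rw [norm_one] at *
    linarith
  have hlog : ∀ z ∈ disk, 0 ≤ -Real.log ‖v z‖ := fun z hz =>
    neg_nonneg.2 (Real.log_nonpos (norm_nonneg _) (hv1 z hz))
  set F : ℕ → Circle → ENNReal := fun n t =>
    ENNReal.ofReal (-Real.log ‖v ((radius n : ℂ) * t)‖) with hF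
  have hcont : ∀ n, Continuous fun t : Circle => Real.log ‖v ((radius n : ℂ) * t)‖ := fun n =>
    (continuous_dilate hvd.continuousOn (radius_mem n)).norm.log fun t =>
      norm_ne_zero_iff.2 (hv0 _ (mul_mem_disk (radius_mem n) t))
  have hmeas : ∀ n, Measurable (F n) := fun n =>
    ENNReal.measurable_ofReal.comp (hcont n).neg.measurable
  have hint : ∀ n, ∫⁻ t, F n t ∂m = ENNReal.ofReal (-Real.log ‖v 0‖) := by
    intro n
    rw [← ofReal_integral_eq_lintegral_ofReal]
    · rw [integral_neg, integral_m_eq_circleAverage (f := fun z => Real.log ‖v z‖) (hcont n)]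
      have hsub : closedBall (0 : ℂ) |radius n| ⊆ disk := by
        rw [abs_of_nonneg (radius_mem n).1]
        exact closedBall_subset_ball (radius_mem n).2
      rw [AnalyticOnNhd.circleAverage_log_norm_of_ne_zero
        ((hvd.analyticOnNhd isOpen_ball).mono hsub) fun z hz => hv0 z (hsub hz)]
    · exact ((hcont n).neg.integrable_of_hasCompactSupport
        (HasCompactSupport.of_compactSpace _))
    · exact .of_forall fun t => hlog _ (mul_mem_disk (radius_mem n) t)
  have hfin : ∫⁻ t, liminf (fun n => F n t) atTop ∂m ≠ ⊤ := by
    refine ne_top_of_le_ne_top ?_ (lintegral_liminf_le hmeas)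
    simp [hint]
  filter_upwards [ae_lt_top (.liminf hmeas) hfin] with t ht hlim
  have hvt : Tendsto (fun n => ‖v ((radius n : ℂ) * t)‖) atTop (𝓝[>] 0) := by
    refine tendsto_nhdsWithin_iff.2 ⟨?_, .of_forall fun n =>
      norm_pos_iff.2 (hv0 _ (mul_mem_disk (radius_mem n) t))⟩
    have := ((hlim.tendsto_radius.const_sub 1).div_const 2).norm
    simpa [hv] using this
  have htop : Tendsto (fun n => F n t) atTop (𝓝 ⊤) :=
    ENNReal.tendsto_ofReal_atTop.comp
      (tendsto_neg_atBot_atTop.comp (Real.tendsto_log_nhdsGT_zero.comp hvt))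
  exact ht.ne htop.liminf_eq

/-! ### Fatou's theorem on radial limits -/

theorem norm_circleAverage_le {f : ℂ → ℂ} {g : ℂ → ℝ} {c : ℂ} {R : ℝ}
    (hg : CircleIntegrable g c R) (h : ∀ z ∈ sphere c |R|, ‖f z‖ ≤ g z) :
    ‖Real.circleAverage f c R‖ ≤ Real.circleAverage g c R := by
  rw [Real.circleAverage, Real.circleAverage, norm_smul, smul_eq_mul,
    Real.norm_of_nonneg (inv_pos.2 Real.two_pi_pos).le]
  refine mul_le_mul_of_nonneg_left ?_ (inv_pos.2 Real.two_pi_pos).le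
  exact intervalIntegral.norm_integral_le_of_norm_le Real.two_pi_pos.le
    (.of_forall fun θ _ => h _ (circleMap_mem_sphere' c R θ)) hg

theorem one_sub_mul_ne_zero_of_mem_closedBall {r : ℝ} (hr : r ∈ Set.Ico (0 : ℝ) 1) {ζ : ℂ}
    (hζ : ζ ∈ closedBall (0 : ℂ) 1) : 1 - (r : ℂ) * ζ ≠ 0 := by
  intro h
  have h1 : ‖(r : ℂ) * ζ‖ = 1 := by rw [← sub_eq_zero.1 h, norm_one]
  rw [norm_mul, Complex.norm_real, Real.norm_of_nonneg hr.1] at h1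
  rw [mem_closedBall_zero_iff] at hζ
  nlinarith [hr.1, hr.2, norm_nonneg ζ]

theorem sub_ne_zero_of_mem_sphere {r : ℝ} (hr : r ∈ Set.Ico (0 : ℝ) 1) {ζ : ℂ}
    (hζ : ζ ∈ sphere (0 : ℂ) 1) : ζ - (r : ℂ) ≠ 0 := by
  intro h
  rw [mem_sphere_zero_iff_norm, sub_eq_zero.1 h, Complex.norm_real, Real.norm_of_nonneg hr.1] at hζ
  exact hr.2.ne hζ

/-- The derivative of a holomorphic function on a radius, as an integral of its boundary values
against a kernel with the decay of the Poisson kernel. -/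
theorem deriv_eq_circleAverage {G : ℂ → ℂ} (hG : DiffContOnCl ℂ G (ball (0 : ℂ) 1)) {r : ℝ}
    (hr : r ∈ Set.Ico (0 : ℝ) 1) :
    deriv G r = Real.circleAverage (fun ζ => ζ * ((1 - (r : ℂ) ^ 2) * (1 - ζ ^ 2)) /
      ((ζ - r) ^ 2 * (1 - r * ζ) ^ 2) * G ζ) 0 1 := by
  have hrd : (r : ℂ) ∈ ball (0 : ℂ) 1 := by
    rw [mem_ball_zero_iff, Complex.norm_real, Real.norm_of_nonneg hr.1]
    exact hr.2
  have hGd : DifferentiableAt ℂ G r := hG.differentiableAt isOpen_ball hrd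
  have hGc : ContinuousOn G (closedBall 0 1) := by
    simpa [closure_ball] using hG.continuousOn
  have hGs : ContinuousOn G (sphere 0 1) := hGc.mono sphere_subset_closedBall
  have hdc : ContinuousOn (dslope G r) (closedBall 0 1) :=
    (continuousOn_dslope (closedBall_mem_nhds_of_mem hrd)).2 ⟨hGc, hGd⟩
  have hds : DiffContOnCl ℂ (dslope G r) (ball (0 : ℂ) |1|) := by
    rw [abs_one]
    exact ⟨(Complex.differentiableOn_dslope (isOpen_ball.mem_nhds hrd)).2 hG.differentiableOn,
      by rwa [closure_ball _ one_ne_zero]⟩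
  have h1 : Real.circleAverage (fun ζ => ((ζ - 0) / (ζ - r)) • dslope G r ζ) 0 1 = deriv G r := by
    rw [hds.circleAverage_smul_div (by rwa [abs_one]), dslope_same]
  -- These integrands are holomorphic and vanish at `0`, so subtracting one from the Cauchy kernel
  -- leaves the derivative unchanged. The subtraction creates the factor `(1 - r²)(1 - ζ²)`.
  have hdiff : ∀ H : ℂ → ℂ, DiffContOnCl ℂ H (ball 0 1) →
      Real.circleAverage (fun ζ => ζ * H ζ / (1 - r * ζ) ^ 2) 0 1 = 0 := by
    intro H hH
    have : DiffContOnCl ℂ (fun ζ => ζ * H ζ / (1 - r * ζ) ^ 2) (ball (0 : ℂ) |1|) := by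
      have hHc : ContinuousOn H (closedBall 0 1) := by simpa [closure_ball] using hH.continuousOn
      rw [abs_one]
      refine ⟨?_, ?_⟩
      · refine (differentiableOn_id.mul hH.differentiableOn).div (by fun_prop) fun ζ hζ => ?_
        exact pow_ne_zero 2 (one_sub_mul_ne_zero_of_mem_closedBall hr (ball_subset_closedBall hζ))
      · rw [closure_ball _ one_ne_zero]
        refine (continuousOn_id.mul hHc).div (by fun_prop) fun ζ hζ => ?_
        exact pow_ne_zero 2 (one_sub_mul_ne_zero_of_mem_closedBall hr hζ)
    rw [this.circleAverage]
    simp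
  have h2 := hdiff G hG
  have h3 : Real.circleAverage (fun ζ => ζ * G r / (ζ - r) ^ 2) 0 1 = 0 := by
    -- The substitution `ζ ↦ ζ⁻¹` moves the double pole from `r` to `1 / r`, outside the closed
    -- disk.
    refine (Real.circleAverage_zero_one_congr_inv
      (f := fun ζ : ℂ => ζ * G r / (ζ - r) ^ 2)).symm.trans
        (Eq.trans ?_ (hdiff (fun _ => G r) diffContOnCl_const))
    refine Real.circleAverage_congr_sphere fun ζ hζ => ?_
    rw [abs_one] at hζ
    have h0 : ζ ≠ 0 := ne_zero_of_mem_unit_sphere ⟨ζ, hζ⟩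
    have h0' := one_sub_mul_ne_zero_of_mem_closedBall hr (sphere_subset_closedBall hζ)
    have : ζ⁻¹ - r = (1 - r * ζ) / ζ := by field_simp
    simp only [this]
    field_simp
  have c1 : CircleIntegrable (fun ζ => ((ζ - 0) / (ζ - r)) • dslope G r ζ) 0 1 := by
    refine ContinuousOn.circleIntegrable zero_le_one ?_
    refine ContinuousOn.smul (ContinuousOn.div (by fun_prop) (by fun_prop) fun ζ hζ =>
      sub_ne_zero_of_mem_sphere hr hζ) (hdc.mono sphere_subset_closedBall)
  have c2 : CircleIntegrable (fun ζ => ζ * G ζ / (1 - r * ζ) ^ 2) 0 1 := by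
    refine ContinuousOn.circleIntegrable zero_le_one ?_
    exact (continuousOn_id.mul hGs).div (by fun_prop) fun ζ hζ => pow_ne_zero 2
      (one_sub_mul_ne_zero_of_mem_closedBall hr (sphere_subset_closedBall hζ))
  have c3 : CircleIntegrable (fun ζ => ζ * G r / (ζ - r) ^ 2) 0 1 := by
    refine ContinuousOn.circleIntegrable zero_le_one ?_
    exact ContinuousOn.div (by fun_prop) (by fun_prop) fun ζ hζ => pow_ne_zero 2
      (sub_ne_zero_of_mem_sphere hr hζ)
  have h4 := Real.circleAverage_fun_sub (c1.add c3) c2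
  rw [Real.circleAverage_add c1 c3, h1, h2, h3, add_zero, sub_zero] at h4
  rw [← h4]
  refine Real.circleAverage_congr_sphere fun ζ hζ => ?_
  rw [abs_one] at hζ
  have hne := sub_ne_zero_of_mem_sphere hr hζ
  have hne' := one_sub_mul_ne_zero_of_mem_closedBall hr (sphere_subset_closedBall hζ)
  simp only [Pi.add_apply, dslope_of_ne G (sub_ne_zero.1 hne), slope_def_field, smul_eq_mul,
    sub_zero]
  have hk : (1 - (r : ℂ) ^ 2) * (1 - ζ ^ 2) = (1 - r * ζ) ^ 2 - (ζ - r) ^ 2 := by ring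
  rw [hk]
  generalize (1 : ℂ) - r * ζ = q at *
  generalize ζ - (r : ℂ) = p at *
  field_simp
  ring

/-- The Poisson kernel has average `1`. -/
theorem circleAverage_poisson {r : ℝ} (hr : r ∈ Set.Ico (0 : ℝ) 1) :
    Real.circleAverage (fun ζ : ℂ => (1 - r ^ 2) / ‖ζ - r‖ ^ 2) 0 1 = 1 := by
  have hrd : (r : ℂ) ∈ ball (0 : ℂ) 1 := by
    rw [mem_ball_zero_iff, Complex.norm_real, Real.norm_of_nonneg hr.1]
    exact hr.2
  have h := DiffContOnCl.circleAverage_poissonKernel_smul' (f := fun _ : ℂ => (1 : ℂ))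
    diffContOnCl_const hrd
  have hc : CircleIntegrable (fun ζ : ℂ => (1 - r ^ 2) / ‖ζ - r‖ ^ 2) 0 1 :=
    ContinuousOn.circleIntegrable zero_le_one <| ContinuousOn.div (by fun_prop) (by fun_prop)
      fun ζ hζ => pow_ne_zero 2 (norm_ne_zero_iff.2 (sub_ne_zero_of_mem_sphere hr hζ))
  have h2 := Complex.ofRealCLM.circleAverage_comp_comm hc
  rw [← Complex.ofReal_inj]
  refine h2.symm.trans (Eq.trans ?_ h)
  refine Real.circleAverage_congr_sphere fun ζ hζ => ?_
  rw [abs_one, mem_sphere_zero_iff_norm] at hζ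
  simp [hζ]

/-- If the boundary values of `G` are `o(ζ - 1)` at `1`, then `G'` has radial limit `0` at `1`. -/
theorem tendsto_deriv_of_isLittleO {G : ℂ → ℂ} (hG : DiffContOnCl ℂ G (ball (0 : ℂ) 1))
    (ho : G =o[𝓝[sphere (0 : ℂ) 1] 1] fun ζ => ζ - 1) :
    Tendsto (fun r : ℝ => deriv G r) (𝓝[<] 1) (𝓝 0) := by
  have hGs : ContinuousOn G (sphere 0 1) := by
    have : ContinuousOn G (closedBall 0 1) := by simpa [closure_ball] using hG.continuousOn
    exact this.mono sphere_subset_closedBall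
  obtain ⟨B, hB⟩ := (isCompact_sphere (0 : ℂ) 1).exists_bound_of_continuousOn hGs
  have hB0 : 0 ≤ B := (norm_nonneg _).trans (hB 1 (by simp))
  have key : ∀ η > 0, ∃ M : ℝ, ∀ r ∈ Set.Ico (0 : ℝ) 1,
      ‖deriv G r‖ ≤ 8 * η + M * (1 - r ^ 2) := by
    intro η hη
    have hev := ho.def hη
    rw [eventually_nhdsWithin_iff, Metric.eventually_nhds_iff] at hev
    obtain ⟨ε, hε, hnear⟩ := hev
    -- One bound for both regimes: far from `1`, `B ≤ (B / ε³) ‖ζ - 1‖³`. The fourth power is chosen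
    -- to cancel the denominator `‖ζ - r‖⁴`, since `‖ζ - 1‖ ≤ 2 ‖ζ - r‖`; the first term becomes `8
    -- η` times the Poisson kernel.
    have hfar : ∀ ζ ∈ sphere (0 : ℂ) 1,
        ‖G ζ‖ * ‖ζ - 1‖ ≤ η * ‖ζ - 1‖ ^ 2 + B / ε ^ 3 * ‖ζ - 1‖ ^ 4 := by
      intro ζ hζ
      rcases lt_or_ge ‖ζ - 1‖ ε with h | h
      · have := hnear (by rwa [dist_eq_norm]) hζ
        have : 0 ≤ B / ε ^ 3 * ‖ζ - 1‖ ^ 4 := by positivity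
        nlinarith [norm_nonneg (ζ - 1)]
      · have h1 : ε ^ 3 ≤ ‖ζ - 1‖ ^ 3 := pow_le_pow_left₀ hε.le h 3
        have h2 : B ≤ B / ε ^ 3 * ‖ζ - 1‖ ^ 3 := by
          rw [div_mul_eq_mul_div, le_div_iff₀ (by positivity)]
          exact mul_le_mul_of_nonneg_left h1 hB0
        have h3 : ‖G ζ‖ * ‖ζ - 1‖ ≤ B / ε ^ 3 * ‖ζ - 1‖ ^ 3 * ‖ζ - 1‖ :=
          mul_le_mul_of_nonneg_right ((hB ζ hζ).trans h2) (norm_nonneg _)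
        nlinarith [mul_nonneg hη.le (sq_nonneg ‖ζ - 1‖)]
    refine ⟨32 * (B / ε ^ 3), fun r hr => ?_⟩
    set M := B / ε ^ 3
    have hM : 0 ≤ M := by positivity
    have hr2 : 0 ≤ 1 - r ^ 2 := by nlinarith [hr.1, hr.2]
    have c1 : CircleIntegrable (fun ζ : ℂ => (1 - r ^ 2) / ‖ζ - r‖ ^ 2) 0 1 :=
      ContinuousOn.circleIntegrable zero_le_one <| ContinuousOn.div (by fun_prop) (by fun_prop)
        fun ζ hζ => pow_ne_zero 2 (norm_ne_zero_iff.2 (sub_ne_zero_of_mem_sphere hr hζ))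
    have c2 : CircleIntegrable (fun ζ : ℂ => (8 * η) • ((1 - r ^ 2) / ‖ζ - r‖ ^ 2)) 0 1 :=
      c1.const_smul
    have c3 : CircleIntegrable (fun _ : ℂ => 32 * M * (1 - r ^ 2)) 0 1 :=
      circleIntegrable_const _ _ _
    have havg : Real.circleAverage (fun ζ : ℂ => (8 * η) • ((1 - r ^ 2) / ‖ζ - r‖ ^ 2) +
        32 * M * (1 - r ^ 2)) 0 1 = 8 * η + 32 * M * (1 - r ^ 2) := by
      rw [Real.circleAverage_fun_add c2 c3, Real.circleAverage_fun_smul, circleAverage_poisson hr,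
        Real.circleAverage_const, smul_eq_mul, mul_one]
    rw [deriv_eq_circleAverage hG hr, ← havg]
    refine norm_circleAverage_le (c2.add c3) fun ζ hζ => ?_
    rw [abs_one] at hζ
    have hne := sub_ne_zero_of_mem_sphere hr hζ
    have hn1 : ‖ζ‖ = 1 := mem_sphere_zero_iff_norm.1 hζ
    have hd : 0 < ‖ζ - r‖ := norm_pos_iff.2 hne
    have hdd : ‖1 - (r : ℂ) * ζ‖ = ‖ζ - r‖ := by
      rw [← sq_eq_sq₀ (norm_nonneg _) (norm_nonneg _)]
      have : ζ.re * ζ.re + ζ.im * ζ.im = 1 := by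
        rw [← Complex.normSq_apply, Complex.normSq_eq_norm_sq, hn1, one_pow]
      simp only [Complex.sq_norm, Complex.normSq_apply, Complex.sub_re, Complex.sub_im,
        Complex.mul_re, Complex.mul_im, Complex.one_re, Complex.one_im, Complex.ofReal_re,
        Complex.ofReal_im]
      linear_combination (r ^ 2 - 1) * this
    have hle : ‖ζ - 1‖ ≤ 2 * ‖ζ - r‖ := by
      have e1 : ‖ζ - 1‖ ≤ ‖ζ - r‖ + ‖(r : ℂ) - 1‖ := by
        simpa using norm_add_le (ζ - r) ((r : ℂ) - 1)
      have e2 : ‖(r : ℂ) - 1‖ = 1 - r := by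
        rw [← Complex.ofReal_one, ← Complex.ofReal_sub, Complex.norm_real, Real.norm_eq_abs,
          abs_of_nonpos (by linarith [hr.2])]
        ring
      have e3 := norm_sub_norm_le ζ r
      rw [hn1, Complex.norm_real, Real.norm_of_nonneg hr.1] at e3
      linarith
    have hsq : ‖1 - ζ ^ 2‖ ≤ 2 * ‖ζ - 1‖ := by
      have : 1 - ζ ^ 2 = -((ζ + 1) * (ζ - 1)) := by ring
      rw [this, norm_neg, norm_mul]
      refine mul_le_mul_of_nonneg_right ?_ (norm_nonneg _)
      have := norm_add_le ζ 1
      rw [hn1, norm_one] at this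
      linarith
    have hrn : ‖(1 : ℂ) - (r : ℂ) ^ 2‖ = 1 - r ^ 2 := by
      rw [← Complex.ofReal_one, ← Complex.ofReal_pow, ← Complex.ofReal_sub, Complex.norm_real,
        Real.norm_of_nonneg hr2]
    simp only [norm_mul, norm_div, norm_pow, hn1, hrn, hdd, smul_eq_mul, one_mul]
    set d := ‖ζ - r‖
    set x := ‖ζ - 1‖
    have hx : 0 ≤ x := norm_nonneg _
    have hx2 : x ^ 2 ≤ 4 * d ^ 2 := by nlinarith
    have hx4 : x ^ 4 ≤ 16 * d ^ 4 := by nlinarith [sq_nonneg x, sq_nonneg d]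
    have hfin : ‖1 - ζ ^ 2‖ * ‖G ζ‖ ≤ 8 * η * d ^ 2 + 32 * M * d ^ 4 := by
      calc ‖1 - ζ ^ 2‖ * ‖G ζ‖ ≤ 2 * x * ‖G ζ‖ := mul_le_mul_of_nonneg_right hsq (norm_nonneg _)
        _ = 2 * (‖G ζ‖ * x) := by ring
        _ ≤ 2 * (η * x ^ 2 + M * x ^ 4) := by linarith [hfar ζ hζ]
        _ ≤ 2 * (η * (4 * d ^ 2) + M * (16 * d ^ 4)) := by gcongr
        _ = _ := by ring
    calc (1 - r ^ 2) * ‖1 - ζ ^ 2‖ / (d ^ 2 * d ^ 2) * ‖G ζ‖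
        = (1 - r ^ 2) * (‖1 - ζ ^ 2‖ * ‖G ζ‖) / d ^ 4 := by ring
      _ ≤ (1 - r ^ 2) * (8 * η * d ^ 2 + 32 * M * d ^ 4) / d ^ 4 := by gcongr
      _ = 8 * η * ((1 - r ^ 2) / d ^ 2) + 32 * M * (1 - r ^ 2) := by field_simp
  rw [Metric.tendsto_nhds]
  intro ε hε
  obtain ⟨M, hM⟩ := key (ε / 16) (by positivity)
  have hlim : Tendsto (fun r : ℝ => 8 * (ε / 16) + M * (1 - r ^ 2)) (𝓝[<] 1)
      (𝓝 (8 * (ε / 16) + M * (1 - 1 ^ 2))) :=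
    (Continuous.tendsto (by fun_prop) 1).mono_left nhdsWithin_le_nhds
  filter_upwards [hlim.eventually_lt_const (u := ε) (by linarith), eventually_mem_Ico] with r h1 h2
  rw [dist_zero_right]
  exact (hM r h2).trans_lt h1

/-- Fatou's theorem at a point where the boundary function of the primitive is differentiable. -/
theorem exists_hasRadialLimit_of_differentiableAt {f F : ℂ → ℂ} (hFc : Continuous F)
    (hF : ∀ z ∈ disk, HasDerivAt F (f z) z) {x : ℝ}
    (hd : DifferentiableAt ℝ (fun θ : ℝ => F (circleMap 0 1 θ)) x) :
    ∃ w, HasRadialLimit f (Circle.exp x) w := by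
  obtain ⟨D, hD⟩ : ∃ D, HasDerivAt (fun θ : ℝ => F (circleMap 0 1 θ)) D x := ⟨_, hd.hasDerivAt⟩
  set t : ℂ := (Circle.exp x : ℂ) with ht
  have htn : ‖t‖ = 1 := Circle.norm_coe _
  have ht0 : t ≠ 0 := Circle.coe_ne_zero _
  -- `A` is the candidate for `t` times the radial limit; division by `I` compensates for `dζ/dθ =
  -- I` at `ζ = 1`. Subtracting the linear part makes `G` small to first order along the circle.
  set A : ℂ := D / Complex.I with hA
  set G : ℂ → ℂ := fun ζ => F (t * ζ) - F t - A * (ζ - 1) with hGdef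
  have hmem : ∀ ζ ∈ disk, t * ζ ∈ disk := fun ζ hζ => by
    rw [mem_ball_zero_iff] at hζ ⊢
    rwa [norm_mul, htn, one_mul]
  have hGd : ∀ ζ ∈ disk, HasDerivAt G (f (t * ζ) * t - A) ζ := by
    intro ζ hζ
    have h1 := (hF _ (hmem ζ hζ)).comp ζ ((hasDerivAt_id ζ).const_mul t)
    have h2 := ((hasDerivAt_id ζ).sub_const 1).const_mul A
    simpa using (h1.sub_const (F t)).fun_sub h2
  have hG : DiffContOnCl ℂ G (ball (0 : ℂ) 1) :=
    ⟨fun ζ hζ => (hGd ζ hζ).differentiableAt.differentiableWithinAt,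
      (by fun_prop : Continuous G).continuousOn⟩
  have hg0 : HasDerivAt (fun θ : ℝ => G (circleMap 0 1 θ)) 0 0 := by
    have h1 : HasDerivAt (fun θ : ℝ => F (circleMap 0 1 (x + θ))) D 0 := by
      have := HasDerivAt.comp_const_add x 0 (f := fun θ : ℝ => F (circleMap 0 1 θ)) (f' := D)
        (by simpa using hD)
      simpa using this
    have h2 : HasDerivAt (fun θ : ℝ => A * (circleMap 0 1 θ - 1)) (A * Complex.I) 0 := by
      simpa [show circleMap 0 1 0 = 1 by simp [circleMap]] using ((hasDerivAt_circleMap 0 1 0).sub_const 1).const_mul A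
    have h3 := (h1.sub_const (F t)).fun_sub h2
    have h4 : D - A * Complex.I = 0 := by
      rw [hA, div_mul_cancel₀ _ Complex.I_ne_zero, sub_self]
    rw [h4] at h3
    refine h3.congr_of_eventuallyEq (.of_forall fun θ => ?_)
    simp only [hGdef, ht, Circle.coe_exp, circleMap, zero_add, Complex.ofReal_one,
      one_mul, ← Complex.exp_add]
    congr 3
    push_cast
    ring_nf
  have hgo : (fun θ : ℝ => G (circleMap 0 1 θ)) =o[𝓝 0] fun θ : ℝ => θ := by
    have := hg0.isLittleO
    simpa [hGdef, circleMap] using this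
  have harg : Tendsto Complex.arg (𝓝[sphere (0 : ℂ) 1] 1) (𝓝 0) := by
    have := (Complex.continuousAt_arg (x := 1) (by simp)).tendsto
    rw [Complex.arg_one] at this
    exact this.mono_left nhdsWithin_le_nhds
  -- `arg` is the imaginary part of `log`, which is differentiable at `1`; this turns `o(θ)` into
  -- `o(ζ - 1)`.
  have hargO : (fun ζ : ℂ => Complex.arg ζ) =O[𝓝[sphere (0 : ℂ) 1] 1] fun ζ => ζ - 1 := by
    have h1 := (Complex.hasStrictDerivAt_log (x := 1) (by simp)).hasDerivAt.isBigO_sub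
    rw [Complex.log_one] at h1
    refine Asymptotics.IsBigO.trans ?_ (h1.mono nhdsWithin_le_nhds)
    refine Asymptotics.IsBigO.of_bound 1 (.of_forall fun ζ => ?_)
    rw [one_mul, sub_zero, Real.norm_eq_abs, ← Complex.log_im]
    exact Complex.abs_im_le_norm _
  have ho : G =o[𝓝[sphere (0 : ℂ) 1] 1] fun ζ => ζ - 1 := by
    refine ((hgo.comp_tendsto harg).trans_isBigO hargO).congr' ?_ .rfl
    filter_upwards [self_mem_nhdsWithin] with ζ hζ
    have hζ1 : ‖ζ‖ = 1 := mem_sphere_zero_iff_norm.1 hζ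
    have h := Complex.norm_mul_exp_arg_mul_I ζ
    rw [hζ1] at h
    simp only [Function.comp_apply, circleMap, zero_add, h]
  refine ⟨A / t, ?_⟩
  have hlim := ((tendsto_deriv_of_isLittleO hG ho).add_const A).div_const t
  rw [zero_add] at hlim
  refine hlim.congr' ?_
  filter_upwards [eventually_mem_Ico] with r hr
  have hrd : (r : ℂ) ∈ disk := by
    rw [mem_ball_zero_iff, Complex.norm_real, Real.norm_of_nonneg hr.1]
    exact hr.2
  rw [(hGd r hrd).deriv, sub_add_cancel, mul_div_cancel_right₀ _ ht0, mul_comm]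

/-- **Fatou's theorem** for Schur functions. -/
theorem ae_exists_hasRadialLimit {f : ℂ → ℂ} (hf : f ∈ schurClass) :
    ∀ᵐ t ∂m, ∃ w, HasRadialLimit f t w := by
  -- A primitive of `f` is `1`-Lipschitz, hence extends to a Lipschitz function whose restriction to
  -- the circle is differentiable almost everywhere.
  obtain ⟨F₀, hF₀⟩ := hf.1.isExactOn_ball
  have hlip : LipschitzOnWith 1 F₀ disk :=
    (convex_ball (0 : ℂ) 1).lipschitzOnWith_of_nnnorm_hasDerivWithin_le
      (fun z hz => (hF₀ z hz).hasDerivWithinAt) fun z hz => hf.2 z hz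
  obtain ⟨F, hFl, hFe⟩ := hlip.extend_finite_dimension
  have hF : ∀ z ∈ disk, HasDerivAt F (f z) z := fun z hz =>
    (hF₀ z hz).congr_of_eventuallyEq
      (mem_of_superset (isOpen_ball.mem_nhds hz) fun w hw => (hFe hw).symm)
  refine ae_m_of_ae ?_
  filter_upwards [(hFl.comp (lipschitzWith_circleMap 0 1)).ae_differentiableAt] with x hx
  exact exists_hasRadialLimit_of_differentiableAt hFl.continuous hF hx

/-! ### Inner functions and the product -/

theorem HasRadialLimit.norm_le_one {s : ℂ → ℂ} (hs : s ∈ schurClass) {t : Circle} {w : ℂ}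
    (h : HasRadialLimit s t w) : ‖w‖ ≤ 1 :=
  le_of_tendsto h.norm (eventually_mem_Ico.mono fun _ hr => hs.2 _ (mul_mem_disk hr t))

/-- With three unimodular boundary values the norm identity has zero right side, so numerator and
denominator have equal modulus; the denominator has a nonzero limit almost everywhere. -/
theorem IsInner.thetaProduct {Θ s₁ s₂ : ℂ → ℂ} (hΘ : IsInner Θ) (hc : ¬ IsConstOnDisk Θ)
    (h₁ : IsInner s₁) (h₂ : IsInner s₂) : IsInner (thetaProduct Θ s₁ s₂) := by
  have h0 := halfSum_mem_schurClass h₁.1 h₂.1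
  have hne := one_sub_mul_ne_zero hΘ.1 h0 hc
  refine ⟨thetaProduct_mem_schurClass hΘ.1 h₁.1 h₂.1 hne, ?_⟩
  filter_upwards [hΘ.2, h₁.2, h₂.2, ae_not_hasRadialLimit_one (schurClass_mul hΘ.1 h0) hne]
    with t ⟨a, ha, hat⟩ ⟨x, hx, hxt⟩ ⟨y, hy, hyt⟩ hnot
  have hs : HasRadialLimit (halfSum s₁ s₂) t ((x + y) / 2) :=
    (Tendsto.add hxt hyt).div_const 2
  have hm : HasRadialLimit (fun z => Θ z * halfSum s₁ s₂ z) t (a * ((x + y) / 2)) :=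
    Tendsto.mul hat hs
  have hd : 1 - a * ((x + y) / 2) ≠ 0 := fun h => hnot (by rwa [← sub_eq_zero.1 h] at hm)
  refine ⟨((x + y) / 2 - a * x * y) / (1 - a * ((x + y) / 2)), ?_,
    (Tendsto.sub hs (Tendsto.mul (Tendsto.mul hat hxt) hyt)).div (Tendsto.const_sub 1 hm) hd⟩
  have h := sq_norm_sub_sq_norm_product a x y
  rw [ha, hx, hy] at h
  have h' : ‖(x + y) / 2 - a * x * y‖ ^ 2 = ‖1 - a * ((x + y) / 2)‖ ^ 2 := by linarith
  rw [norm_div, (sq_eq_sq₀ (norm_nonneg _) (norm_nonneg _)).1 h', div_self (norm_ne_zero_iff.2 hd)]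

theorem IsInner.of_thetaProduct_left {Θ s₁ s₂ : ℂ → ℂ} (hΘ : IsInner Θ) (hc : ¬ IsConstOnDisk Θ)
    (h₁ : s₁ ∈ schurClass) (h₂ : s₂ ∈ schurClass) (h : IsInner (ThetaProduct.thetaProduct Θ s₁ s₂)) :
    IsInner s₁ := by
  have hne := one_sub_mul_ne_zero hΘ.1 (halfSum_mem_schurClass h₁ h₂) hc
  refine ⟨h₁, ?_⟩
  filter_upwards [hΘ.2, h.2, ae_exists_hasRadialLimit h₁, ae_exists_hasRadialLimit h₂,
    ae_not_hasRadialLimit_one (schurClass_mul hΘ.1 h₂) (one_sub_mul_ne_zero hΘ.1 h₂ hc)]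
    with t ⟨a, ha, hat⟩ ⟨w, hw, hwt⟩ ⟨x, hxt⟩ ⟨y, hyt⟩ hnot
  refine ⟨x, ?_, hxt⟩
  have hs : HasRadialLimit (halfSum s₁ s₂) t ((x + y) / 2) :=
    (Tendsto.add hxt hyt).div_const 2
  have hden : HasRadialLimit (fun z => 1 - Θ z * halfSum s₁ s₂ z) t (1 - a * ((x + y) / 2)) :=
    Tendsto.const_sub 1 (Tendsto.mul hat hs)
  have hnum : HasRadialLimit (fun z => halfSum s₁ s₂ z - Θ z * s₁ z * s₂ z) t
      ((x + y) / 2 - a * x * y) := Tendsto.sub hs (Tendsto.mul (Tendsto.mul hat hxt) hyt)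
  -- The relation is kept free of division, so no separate check that the limit of the denominator
  -- is nonzero is needed.
  have heq : (x + y) / 2 - a * x * y = w * (1 - a * ((x + y) / 2)) := by
    refine tendsto_nhds_unique hnum (Tendsto.congr' ?_ (Tendsto.mul hwt hden))
    filter_upwards [eventually_mem_Ico] with r hr
    exact div_mul_cancel₀ _ (hne _ (mul_mem_disk hr t))
  have hx1 := HasRadialLimit.norm_le_one h₁ hxt
  have hy1 := HasRadialLimit.norm_le_one h₂ hyt
  have hd : 1 - a * y ≠ 0 := fun h => hnot (by
    have := Tendsto.mul hat hyt
    rwa [← sub_eq_zero.1 h] at this)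
  have hid := sq_norm_sub_sq_norm_product a x y
  rw [heq, norm_mul, hw, ha, one_mul] at hid
  have hpos : 0 < ‖1 - a * y‖ ^ 2 := by positivity
  have hx2 : 0 ≤ 1 - ‖x‖ ^ 2 := by nlinarith [norm_nonneg x]
  have hy2 : 0 ≤ 1 - ‖y‖ ^ 2 := by nlinarith [norm_nonneg y]
  have hp1 := mul_nonneg hx2 hpos.le
  have hp2 := mul_nonneg hy2 (sq_nonneg ‖1 - a * x‖)
  have hz : (1 - ‖x‖ ^ 2) * ‖1 - a * y‖ ^ 2 = 0 := by linarith
  have hx3 : 1 - ‖x‖ ^ 2 = 0 := (mul_eq_zero.1 hz).resolve_right hpos.ne'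
  nlinarith [norm_nonneg x]

theorem thetaProduct_comm (Θ s₁ s₂ : ℂ → ℂ) : thetaProduct Θ s₁ s₂ = thetaProduct Θ s₂ s₁ := by
  funext z
  simp only [thetaProduct, halfSum, add_comm (s₁ z), mul_right_comm]

theorem isInner_thetaProduct_iff {Θ s₁ s₂ : ℂ → ℂ} (hΘ : IsInner Θ) (hc : ¬ IsConstOnDisk Θ)
    (h₁ : s₁ ∈ schurClass) (h₂ : s₂ ∈ schurClass) :
    IsInner (thetaProduct Θ s₁ s₂) ↔ IsInner s₁ ∧ IsInner s₂ :=
  ⟨fun h => ⟨IsInner.of_thetaProduct_left hΘ hc h₁ h₂ h,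
    IsInner.of_thetaProduct_left hΘ hc h₂ h₁ (thetaProduct_comm Θ s₁ s₂ ▸ h)⟩,
    fun h => IsInner.thetaProduct hΘ hc h.1 h.2⟩

/-! ### Averages of measures and their parameters -/

theorem integrable_boundary_mul {σ : Measure Circle} {f g : ℂ → ℂ} (hf : MemLp (boundary f) 2 σ)
    (hg : MemLp (boundary g) 2 σ) :
    Integrable (fun t => boundary f t * conj (boundary g t)) σ :=
  hf.integrable_mul hg.star

theorem memLp_two_add_measure {f : Circle → ℂ} {μ ν : Measure Circle} (hμ : MemLp f 2 μ)
    (hν : MemLp f 2 ν) : MemLp f 2 (μ + ν) :=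
  (memLp_two_iff_integrable_sq_norm (hμ.1.add_measure hν.1)).2 <|
    ((memLp_two_iff_integrable_sq_norm hμ.1).1 hμ).add_measure
      ((memLp_two_iff_integrable_sq_norm hν.1).1 hν)

/-- The set `S(Θ)` is closed under averaging. -/
theorem average_mem_isometricMeasures {Θ : ℂ → ℂ} {σ₁ σ₂ : Measure Circle}
    (h₁ : σ₁ ∈ isometricMeasures Θ) (h₂ : σ₂ ∈ isometricMeasures Θ) :
    (2⁻¹ : ENNReal) • (σ₁ + σ₂) ∈ isometricMeasures Θ := by
  obtain ⟨hfin₁, hm₁, hi₁⟩ := h₁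
  obtain ⟨hfin₂, hm₂, hi₂⟩ := h₂
  have h2 : (2⁻¹ : ENNReal) ≠ ⊤ := by simp
  refine ⟨Measure.smul_finite _ h2, fun f hf => ⟨?_, ?_⟩, fun f hf g hg => ?_⟩
  · exact Measure.ae_smul_measure (ae_add_measure_iff.2 ⟨(hm₁ f hf).1, (hm₂ f hf).1⟩) _
  · exact (memLp_two_add_measure (hm₁ f hf).2 (hm₂ f hf).2).smul_measure h2
  · rw [integral_smul_measure, integral_add_measure
      (integrable_boundary_mul (hm₁ f hf).2 (hm₁ g hg).2)
      (integrable_boundary_mul (hm₂ f hf).2 (hm₂ g hg).2), hi₁ f hf g hg, hi₂ f hf g hg,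
      ← two_smul ℝ, smul_smul]
    simp

theorem integrable_herglotz (σ : Measure Circle) [IsFiniteMeasure σ] {z : ℂ} (hz : z ∈ disk) :
    Integrable (fun t : Circle => ((t : ℂ) + z) / ((t : ℂ) - z)) σ := by
  have hc : Continuous fun t : Circle => ((t : ℂ) + z) / ((t : ℂ) - z) := by
    refine Continuous.div (by fun_prop) (by fun_prop) fun t ht => ?_
    rw [mem_ball_zero_iff, ← sub_eq_zero.1 ht, Circle.norm_coe] at hz
    exact lt_irrefl _ hz
  exact hc.integrable_of_hasCompactSupport (HasCompactSupport.of_compactSpace _)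

/-- The `Θ`-product of parameters is a parameter of the average. -/
theorem IsParameter.thetaProduct {Θ ω₁ ω₂ : ℂ → ℂ} {σ₁ σ₂ : Measure Circle} [IsFiniteMeasure σ₁]
    [IsFiniteMeasure σ₂] (hΘ : Θ ∈ schurClass) (h₁ : IsParameter Θ σ₁ ω₁)
    (h₂ : IsParameter Θ σ₂ ω₂) :
    IsParameter Θ ((2⁻¹ : ENNReal) • (σ₁ + σ₂)) (thetaProduct Θ ω₁ ω₂) := by
  obtain ⟨hs₁, hn₁, β₁, hβ₁⟩ := h₁
  obtain ⟨hs₂, hn₂, β₂, hβ₂⟩ := h₂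
  have hd : ∀ z ∈ disk, 1 - Θ z * halfSum ω₁ ω₂ z ≠ 0 := by
    intro z hz h
    refine hn₁ z hz (sub_eq_zero.2 (eq_one_of_midpoint_eq_one
      (norm_mul_le_one (hΘ.2 z hz) (hs₁.2 z hz)) (norm_mul_le_one (hΘ.2 z hz) (hs₂.2 z hz))
      ?_).symm)
    rw [halfSum] at h
    linear_combination -h
  have hone : ∀ z ∈ disk, 1 - Θ z * ThetaProduct.thetaProduct Θ ω₁ ω₂ z =
      (1 - Θ z * ω₁ z) * (1 - Θ z * ω₂ z) / (1 - Θ z * halfSum ω₁ ω₂ z) := by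
    intro z hz
    rw [ThetaProduct.thetaProduct, eq_div_iff (hd z hz), sub_mul, mul_assoc,
      div_mul_cancel₀ _ (hd z hz), halfSum]
    ring
  have hne : ∀ z ∈ disk, 1 - Θ z * ThetaProduct.thetaProduct Θ ω₁ ω₂ z ≠ 0 := fun z hz => by
    rw [hone z hz]
    exact div_ne_zero (mul_ne_zero (hn₁ z hz) (hn₂ z hz)) (hd z hz)
  refine ⟨thetaProduct_mem_schurClass hΘ hs₁ hs₂ hd, hne, (β₁ + β₂) / 2, fun z hz => ?_⟩
  have hherg : ∀ u : ℂ, 1 - u ≠ 0 → (1 + u) / (1 - u) = 2 / (1 - u) - 1 := fun u hu => by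
    field_simp
    ring
  rw [integral_smul_measure, integral_add_measure (integrable_herglotz σ₁ hz)
    (integrable_herglotz σ₂ hz), hherg _ (hne z hz), hone z hz]
  have e₁ := hβ₁ z hz
  have e₂ := hβ₂ z hz
  rw [hherg _ (hn₁ z hz)] at e₁
  rw [hherg _ (hn₂ z hz)] at e₂
  -- The factorization `hone` says that `1 / (1 - Θ ω)` for the product is the mean of its values
  -- for `ω₁` and `ω₂`.
  have e₃ : 2 / ((1 - Θ z * ω₁ z) * (1 - Θ z * ω₂ z) / (1 - Θ z * halfSum ω₁ ω₂ z)) =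
      (2 / (1 - Θ z * ω₁ z) + 2 / (1 - Θ z * ω₂ z)) / 2 := by
    have := hn₁ z hz
    have := hn₂ z hz
    rw [div_div_eq_mul_div, div_eq_div_iff (by positivity) two_ne_zero, halfSum]
    field_simp
    ring
  rw [e₃, Complex.real_smul]
  push_cast
  simp only [ENNReal.toReal_inv, ENNReal.toReal_ofNat, Complex.ofReal_inv, Complex.ofReal_ofNat]
  linear_combination (e₁ + e₂) / 2

/-! ### Uniqueness of the parameter -/

/-- Division by an inner function does not increase the supremum norm of a bounded holomorphic
function. -/
theorem norm_le_one_of_norm_inner_mul_le {Θ G : ℂ → ℂ} (hΘ : IsInner Θ)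
    (hG : DifferentiableOn ℂ G disk) {C : ℝ} (hC : ∀ z ∈ disk, ‖G z‖ ≤ C)
    (h : ∀ z ∈ disk, ‖Θ z * G z‖ ≤ 1) : ‖G 0‖ ≤ 1 := by
  -- The majorant comes from `‖G‖ = ‖Θ‖‖G‖ + (1 - ‖Θ‖)‖G‖ ≤ 1 + C (1 - ‖Θ‖)`. Its mean tends to `1`,
  -- so boundary values of `G` are never needed.
  have hcont : ∀ n, Continuous fun t : Circle => 1 + C * (1 - ‖Θ ((radius n : ℂ) * t)‖) := fun n =>
    continuous_const.add (continuous_const.mul (continuous_const.sub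
      (continuous_dilate hΘ.1.1.continuousOn (radius_mem n)).norm))
  have hlim : Tendsto (fun n => ∫ t : Circle, (1 + C * (1 - ‖Θ ((radius n : ℂ) * t)‖)) ∂m) atTop
      (𝓝 (∫ _ : Circle, (1 : ℝ) ∂m)) := by
    refine tendsto_integral_of_dominated_convergence (fun _ => 1 + |C|)
      (fun n => (hcont n).aestronglyMeasurable) (integrable_const _) (fun n => ?_) ?_
    · refine .of_forall fun t => ?_
      have h1 := hΘ.1.2 _ (mul_mem_disk (radius_mem n) t)
      have h2 := norm_nonneg (Θ ((radius n : ℂ) * t))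
      refine (norm_add_le _ _).trans ?_
      rw [norm_one, norm_mul, Real.norm_eq_abs, Real.norm_eq_abs]
      have h3 : |1 - ‖Θ ((radius n : ℂ) * t)‖| ≤ 1 := by
        rw [abs_le]
        constructor <;> linarith
      nlinarith [abs_nonneg C]
    · filter_upwards [hΘ.2] with t ⟨w, hw, hwt⟩
      have := ((hwt.tendsto_radius.norm.const_sub 1).const_mul C).const_add 1
      simpa [hw] using this
  rw [integral_const, probReal_univ, smul_eq_mul, one_mul] at hlim
  refine ge_of_tendsto' hlim fun n => ?_
  rw [← integral_m_dilate hG (radius_mem n)]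
  refine norm_integral_le_of_norm_le ((hcont n).integrable_of_hasCompactSupport
    (HasCompactSupport.of_compactSpace _)) (.of_forall fun t => ?_)
  have hz := mul_mem_disk (radius_mem n) t
  have h1 := h _ hz
  rw [norm_mul] at h1
  nlinarith [hC _ hz, hΘ.1.2 _ hz]

theorem norm_le_norm_add_real {w : ℂ} (hw : 0 ≤ w.re) {ε : ℝ} (hε : 0 ≤ ε) :
    ‖w‖ ≤ ‖w + ε‖ ∧ ε ≤ ‖w + ε‖ := by
  constructor
  · refine le_of_sq_le_sq ?_ (norm_nonneg _)
    simp only [Complex.sq_norm, Complex.normSq_apply, Complex.add_re, Complex.add_im,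
      Complex.ofReal_re, Complex.ofReal_im]
    nlinarith [mul_nonneg hw hε]
  · have := Complex.re_le_norm (w + ε)
    rw [Complex.add_re, Complex.ofReal_re] at this
    linarith

/-- A nonconstant inner function `Θ` does not divide, with bounded holomorphic quotient, the
product of two nonvanishing holomorphic functions with nonnegative real part. -/
theorem not_eq_inner_mul {Θ F₁ F₂ H : ℂ → ℂ} (hΘ : IsInner Θ) (hc : ¬ IsConstOnDisk Θ)
    (h₁ : DifferentiableOn ℂ F₁ disk) (h₂ : DifferentiableOn ℂ F₂ disk)
    (hr₁ : ∀ z ∈ disk, 0 ≤ (F₁ z).re) (hr₂ : ∀ z ∈ disk, 0 ≤ (F₂ z).re)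
    (hn₁ : F₁ 0 ≠ 0) (hn₂ : F₂ 0 ≠ 0) (hH : DifferentiableOn ℂ H disk) {C : ℝ}
    (hC : ∀ z ∈ disk, ‖H z‖ ≤ C) : ¬ ∀ z ∈ disk, F₁ z * F₂ z = Θ z * H z := by
  intro h
  have h0 : (0 : ℂ) ∈ disk := mem_ball_self one_pos
  -- Adding `ε` bounds the factors away from zero without decreasing their modulus, so the quotient
  -- of `H` by their product is bounded. Letting `ε` tend to `0` gives `‖H 0‖ ≤ ‖Θ 0‖ ‖H 0‖` with `H
  -- 0 ≠ 0`.
  have key : ∀ ε : ℝ, 0 < ε → ‖H 0‖ ≤ ‖(F₁ 0 + ε) * (F₂ 0 + ε)‖ := by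
    intro ε hε
    have hp : ∀ z ∈ disk, ε * ε ≤ ‖(F₁ z + ε) * (F₂ z + ε)‖ := fun z hz => by
      rw [norm_mul]
      exact mul_le_mul (norm_le_norm_add_real (hr₁ z hz) hε.le).2
        (norm_le_norm_add_real (hr₂ z hz) hε.le).2 hε.le (norm_nonneg _)
    have hpos : ∀ z ∈ disk, 0 < ‖(F₁ z + ε) * (F₂ z + ε)‖ := fun z hz =>
      (mul_pos hε hε).trans_le (hp z hz)
    have := norm_le_one_of_norm_inner_mul_le (G := fun z => H z / ((F₁ z + ε) * (F₂ z + ε)))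
      (C := C / (ε * ε)) hΘ
      (hH.div ((h₁.add_const _).mul (h₂.add_const _)) fun z hz => norm_pos_iff.1 (hpos z hz))
      (fun z hz => ?_) (fun z hz => ?_)
    · rwa [norm_div, div_le_one (hpos 0 h0)] at this
    · rw [norm_div]
      exact div_le_div₀ ((norm_nonneg _).trans (hC z hz)) (hC z hz) (by positivity) (hp z hz)
    · rw [← mul_div_assoc, ← h z hz, norm_div, div_le_one (hpos z hz), norm_mul, norm_mul]
      exact mul_le_mul (norm_le_norm_add_real (hr₁ z hz) hε.le).1
        (norm_le_norm_add_real (hr₂ z hz) hε.le).1 (norm_nonneg _) (norm_nonneg _)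
  have hlim : Tendsto (fun ε : ℝ => ‖(F₁ 0 + ε) * (F₂ 0 + ε)‖) (𝓝[>] 0)
      (𝓝 ‖(F₁ 0 + (0 : ℝ)) * (F₂ 0 + (0 : ℝ))‖) :=
    (Continuous.tendsto (by fun_prop) 0).mono_left nhdsWithin_le_nhds
  have hle := ge_of_tendsto hlim (mem_of_superset self_mem_nhdsWithin fun ε hε => key ε hε)
  rw [Complex.ofReal_zero, add_zero, add_zero, h 0 h0, norm_mul] at hle
  have hH0 : 0 < ‖H 0‖ := norm_pos_iff.2 fun hz =>
    mul_ne_zero hn₁ hn₂ (by rw [h 0 h0, hz, mul_zero])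
  have h1 : 1 ≤ ‖Θ 0‖ := by
    by_contra! hlt
    nlinarith
  exact hc ⟨Θ 0, eqOn_const_of_norm_eq_one hΘ.1 h0 h1⟩

/-- For nonconstant `Θ` a measure has at most one parameter. -/
theorem IsParameter.eqOn {Θ ω ω' : ℂ → ℂ} {σ : Measure Circle} (hΘ : IsInner Θ)
    (hc : ¬ IsConstOnDisk Θ) (h : IsParameter Θ σ ω) (h' : IsParameter Θ σ ω') :
    Set.EqOn ω ω' disk := by
  obtain ⟨hs, hn, β, hβ⟩ := h
  obtain ⟨hs', hn', β', hβ'⟩ := h'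
  -- The Herglotz integrals cancel, leaving only the difference of the two imaginary constants.
  have hmain : ∀ z ∈ disk, 2 * (Θ z * (ω z - ω' z)) =
      Complex.I * ((β - β' : ℝ) : ℂ) * ((1 - Θ z * ω z) * (1 - Θ z * ω' z)) := by
    intro z hz
    have e : (1 + Θ z * ω z) / (1 - Θ z * ω z) - (1 + Θ z * ω' z) / (1 - Θ z * ω' z) =
        Complex.I * ((β - β' : ℝ) : ℂ) := by
      rw [hβ z hz, hβ' z hz]
      push_cast
      ring
    rw [← e, div_sub_div _ _ (hn z hz) (hn' z hz),
      div_mul_cancel₀ _ (mul_ne_zero (hn z hz) (hn' z hz))]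
    ring
  have hd : DifferentiableOn ℂ (fun z => ω z - ω' z) disk := hs.1.sub hs'.1
  rcases eq_or_ne β β' with hb | hb
  · have hz : ∀ z ∈ disk, Θ z * (ω z - ω' z) = 0 := fun z hz => by
      have := hmain z hz
      rw [hb, sub_self, Complex.ofReal_zero, mul_zero, zero_mul] at this
      exact (mul_eq_zero.1 this).resolve_left two_ne_zero
    rcases AnalyticOnNhd.eq_zero_or_eq_zero_of_mul_eq_zero (hΘ.1.1.analyticOnNhd isOpen_ball)
      (hd.analyticOnNhd isOpen_ball) hz (convex_ball (0 : ℂ) 1).isPreconnected with h0 | h0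
    · exact absurd ⟨0, h0⟩ hc
    · exact fun z hz => sub_eq_zero.1 (h0 z hz)
  · exfalso
    have hre : ∀ {s : ℂ → ℂ}, s ∈ schurClass → ∀ z ∈ disk, 0 ≤ (1 - Θ z * s z).re :=
      fun {s} hs z hz => by
        have := (Complex.re_le_norm _).trans (norm_mul_le_one (hΘ.1.2 z hz) (hs.2 z hz))
        rw [Complex.sub_re, Complex.one_re]
        linarith
    have h0 : (0 : ℂ) ∈ disk := mem_ball_self one_pos
    set k : ℂ := Complex.I * ((β - β' : ℝ) : ℂ) with hk
    have hk0 : k ≠ 0 := mul_ne_zero Complex.I_ne_zero (Complex.ofReal_ne_zero.2 (sub_ne_zero.2 hb))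
    refine not_eq_inner_mul hΘ hc ((differentiableOn_const 1).sub (hΘ.1.1.mul hs.1))
      ((differentiableOn_const 1).sub (hΘ.1.1.mul hs'.1)) (hre hs) (hre hs') (hn 0 h0) (hn' 0 h0)
      (H := fun z => 2 / k * (ω z - ω' z)) (C := ‖2 / k‖ * 2) (hd.const_mul _) (fun z hz => ?_)
      fun z hz => ?_
    · rw [norm_mul]
      refine mul_le_mul_of_nonneg_left ?_ (norm_nonneg _)
      linarith [norm_sub_le (ω z) (ω' z), hs.2 z hz, hs'.2 z hz]
    · have := hmain z hz
      simp only [Pi.sub_apply, Pi.mul_apply]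
      field_simp
      linear_combination -this

end ThetaProduct


/-! ### The proposition -/

theorem proposition3 (Θ : ℂ → ℂ) (hΘ : ThetaProduct.IsInner Θ) :
    -- the product is a well defined operation on the Schur class
    (∀ s₁ ∈ ThetaProduct.schurClass, ∀ s₂ ∈ ThetaProduct.schurClass,
      ¬ ThetaProduct.Degenerate Θ s₁ s₂ →
        (∀ z ∈ ThetaProduct.disk, 1 - Θ z * ThetaProduct.halfSum s₁ s₂ z ≠ 0) ∧
        ThetaProduct.thetaProduct Θ s₁ s₂ ∈ ThetaProduct.schurClass) ∧
    -- it is idempotent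
    (∀ s ∈ ThetaProduct.schurClass, ¬ ThetaProduct.Degenerate Θ s s →
      Set.EqOn (ThetaProduct.thetaProduct Θ s s) s ThetaProduct.disk) ∧
    -- inner products
    (¬ ThetaProduct.IsConstOnDisk Θ →
      ∀ s₁ ∈ ThetaProduct.schurClass, ∀ s₂ ∈ ThetaProduct.schurClass,
        (ThetaProduct.IsInner (ThetaProduct.thetaProduct Θ s₁ s₂) ↔
          ThetaProduct.IsInner s₁ ∧ ThetaProduct.IsInner s₂)) ∧
    -- averaging of measures
    (∀ σ₁ ∈ ThetaProduct.isometricMeasures Θ, ∀ σ₂ ∈ ThetaProduct.isometricMeasures Θ,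
      (2⁻¹ : ENNReal) • (σ₁ + σ₂) ∈ ThetaProduct.isometricMeasures Θ ∧
      ∀ ω₁ ω₂ : ℂ → ℂ,
        ThetaProduct.IsParameter Θ σ₁ ω₁ → ThetaProduct.IsParameter Θ σ₂ ω₂ →
        ThetaProduct.IsParameter Θ ((2⁻¹ : ENNReal) • (σ₁ + σ₂))
          (ThetaProduct.thetaProduct Θ ω₁ ω₂) ∧
        (¬ ThetaProduct.IsConstOnDisk Θ →
          ∀ ω : ℂ → ℂ, ThetaProduct.IsParameter Θ ((2⁻¹ : ENNReal) • (σ₁ + σ₂)) ω →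
            Set.EqOn ω (ThetaProduct.thetaProduct Θ ω₁ ω₂) ThetaProduct.disk)) := by

  open ThetaProduct in
  refine ⟨fun s₁ h₁ s₂ h₂ hd => ?_, fun s hs hd z hz => ?_, fun hc s₁ h₁ s₂ h₂ => ?_,
    fun σ₁ h₁ σ₂ h₂ => ⟨?_, fun ω₁ ω₂ p₁ p₂ => ?_⟩⟩
  · have hne := one_sub_mul_halfSum_ne_zero hΘ.1 h₁ h₂ hd
    exact ⟨hne, thetaProduct_mem_schurClass hΘ.1 h₁ h₂ hne⟩
  · exact thetaProduct_self (one_sub_mul_halfSum_ne_zero hΘ.1 hs hs hd z hz)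
  · exact isInner_thetaProduct_iff hΘ hc h₁ h₂
  · exact average_mem_isometricMeasures h₁ h₂
  · have := h₁.1
    have := h₂.1
    have hp := p₁.thetaProduct hΘ.1 p₂
    exact ⟨hp, fun hc ω hω => hω.eqOn hΘ hc hp⟩
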